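/- **Setting.** Let $P$ be a probability measure on $\mathcal X\times\{1,\dots,C\}$, with class probabilities $p(i)=P(y=i)$, conditional laws $P_i=P(x\in\cdot\mid y=i)$ and class regions $\mathcal M_i\subseteq\mathcal X$ such that $x\in\mathcal M_y$ almost surely. A classifier is a pair $(M,f(\cdot;w))$ with weight vectors $M_1,\dots,M_C\in\mathbb R^d$ and a feature extractor $f(\cdot;w):\mathcal X\to\mathbb R^d$. For a given set of admissible $(M,w)$, let $$\mathcal F=\{(M_i-M_j)^{T}f(\cdot;w): i\ne j,\ (M,w)\text{ admissible}\},$$ and let $K>0$ be such that $|g(x)|\le K$ for all $g\in\mathcal F$, all $i$ and all $x\in\mathcal M_i$. For a dataset $S$ of size $N$, let $S_i$ be its samples of class $i$ and $N_i=|S_i|$. Let $\mathfrak R_{N_i}(\mathcal F)=\mathbb E\sup_{g\in\mathcal F}\big|\frac1{N_i}\sum_{k=1}^{N_i}\sigma_k g(x_k)\big|$ be the Rademacher complexity for i.i.d. $x_k\sim P_i$ and independent uniform signs $\sigma_k$. Given $\gamma_{ij}>0$ $(i\neq j)$, $\delta\in(0,1)$ and an admissible classifier, the multiclass margin bound is $$B=\sum_{i}p(i)\sum_{j\ne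 i}\frac{\mathfrak R_{N_i}(\mathcal F)}{\gamma_{ij}}+\sum_{i}p(i)\sum_{j\ne i}\sqrt{\frac{\log\log_2(4K/\gamma_{ij})}{N_i}}+L_{0,1}+\sum_{i}p(i)\sum_{j\neq i}\sqrt{\frac{\log(C(C-1)/\delta)}{2N_i}},$$ $$L_{0,1}=\sum_i p(i)\sum_{j\ne i}\frac1{N_i}\sum_{x\in S_i}\mathbb I\big((M_i-M_j)^Tf(x;w)\le\gamma_{ij}\big).$$ The *margin terms* of $B$ are its first two sums. The *minority margin terms* are the part of those two sums that belongs to pairs $i\ne j$ in $\mathcal C_2=\{C_1+1,\dots,C\}$, where $0\le C_1\le C$. (The iterated logarithm is nonnegative when $\gamma_{ij}\le 2K$. For $\gamma_{ij}>2K$ the identities below are identities between formal expressions, with the same convention on both sides.) **Statement.** Suppose each of the classes $1,\dots,C_1$ has $N_1\geq 1$ samples in $S$, each class in $\mathcal C_2$ has $N_2\ge1$ samples, and $p(i)=N_i/N$ for all $i$. Put $R=N_1/N_2$. 1. The minority margin terms equal $$T=\sum_{i\in\mathcal C_2}\ \sum_{j\in\mathcal C_2\setminus\{i\}}\frac{1}{C_1R+C-C_1}\left(\frac{\mathfrak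 R_{N_2}(\mathcal F)}{\gamma_{ij}}+\sqrt{\frac{\log\log_2(4K/\gamma_{ij})}{N_2}}\right),$$ where $\mathfrak R_{N_2}(\mathcal F)$ in the $i$-th summand is taken with respect to $P_i$. Consequently $B$ is the sum of $T$, the margin terms of all other ordered pairs $i\neq j$, $L_{0,1}$, and the last sum in $B$. 2. Let $C_1\ge1$ and $C-C_1\ge2$, and consider a sequence of such imbalanced problems (the data laws, the datasets, and $N_1,N_2\ge1$ may vary; $C$, $C_1$, $f$, the admissible set, the regions $\mathcal M_i$ and $K$ are fixed) with $R\to\infty$. Let $c>0$. (a) If $0<\gamma_{ij}\le 2K$ for all minority pairs and the minority margin terms are eventually at least $c$ (for instance, if they stay constant and equal to $c$), then $\min_{i\ne j\in\mathcal C_2}\gamma_{ij}\to0$. (b) There are margins $0<\gamma_{ij}\le 2K$ along the sequence such that $\gamma_{ij}\to0$ for every minority pair $i\neq j$, while the minority margin terms are equal to $c$ for all sufficiently large indices of the sequence. -/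

import Mathlib

open MeasureTheory ProbabilityTheory Filter Topology
open scoped ENNReal

noncomputable section

namespace MarginBound

/-- `N_i`: the number of samples of class `i` in a labelled dataset `S` of size `N`. -/
def classCount {X : Type*} {C N : ℕ} (S : Fin N → X × Fin C) (i : Fin C) : ℕ :=
  (Finset.univ.filter fun k => (S k).2 = i).card

/-- `p(i)`: the probability of the label `i` under the joint law `P` of `(x, y)`. -/
def classProb {X : Type*} [MeasurableSpace X] {C : ℕ} (P : Measure (X × Fin C))
    (i : Fin C) : ℝ :=
  P.real (Prod.snd ⁻¹' {i})

/-- The conditional law of `x` given `y = i`. -/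
def classCond {X : Type*} [MeasurableSpace X] {C : ℕ} (P : Measure (X × Fin C))
    (i : Fin C) : Measure X :=
  (P[|Prod.snd ⁻¹' {i}]).map Prod.fst

/-- The margin function `(M_i - M_j)ᵀ φ(x)` of the classifier with last layer `M`
and feature extractor `φ`. -/
def marginFun {X : Type*} {C d : ℕ} (M : Fin C → EuclideanSpace ℝ (Fin d))
    (φ : X → EuclideanSpace ℝ (Fin d)) (i j : Fin C) (x : X) : ℝ :=
  inner ℝ (M i - M j) (φ x)

/-- The class `𝓕` of all margin functions, for `i ≠ j` and `(M, w)` ranging over the set `H` of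
admissible classifiers; `f w` is the feature extractor with parameter `w`. -/
def marginClass {X W : Type*} {C d : ℕ} (f : W → X → EuclideanSpace ℝ (Fin d))
    (H : Set ((Fin C → EuclideanSpace ℝ (Fin d)) × W)) : Set (X → ℝ) :=
  {g | ∃ h ∈ H, ∃ i j : Fin C, i ≠ j ∧ g = marginFun h.1 (f h.2) i j}

/-- The Rademacher complexity `E_x E_σ sup_{g ∈ F} |(1/n) ∑ₖ σₖ g(xₖ)|`, with `x₁, …, xₙ` i.i.d.
of law `D` and independent uniform signs `σₖ`. (A class of margin functions is closed under
negation, so the absolute value does not change the supremum.) -/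
def rademacher {X : Type*} [MeasurableSpace X] (D : Measure X) (n : ℕ)
    (F : Set (X → ℝ)) : ℝ :=
  (∫⁻ x : Fin n → X,
    (∑ σ : Fin n → ℤˣ,
      ⨆ g ∈ F, ENNReal.ofReal |(1 / (n : ℝ)) * ∑ k, ((σ k : ℤ) : ℝ) * g (x k)|) / 2 ^ n
    ∂(Measure.pi fun _ => D)).toReal

/-- `√(log(log₂(4K/γ)) / n)`. -/
def confidence (K γ : ℝ) (n : ℕ) : ℝ :=
  Real.sqrt (Real.log (Real.logb 2 (4 * K / γ)) / n)

/-- The empirical risk term of the multiclass margin bound. -/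
def empiricalRisk {X : Type*} [MeasurableSpace X] {C d N : ℕ} (P : Measure (X × Fin C))
    (S : Fin N → X × Fin C) (M : Fin C → EuclideanSpace ℝ (Fin d))
    (φ : X → EuclideanSpace ℝ (Fin d)) (γ : Fin C → Fin C → ℝ) : ℝ :=
  open Classical in
  ∑ i, classProb P i * ∑ j ∈ Finset.univ.erase i,
    ∑ k ∈ Finset.univ.filter (fun k => (S k).2 = i),
      (if marginFun M φ i j (S k).1 ≤ γ i j then (1 : ℝ) else 0) / classCount S i

/-- The probability term of the multiclass margin bound at confidence level `1 - δ`. -/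
def probabilityTerm {X : Type*} [MeasurableSpace X] {C N : ℕ} (P : Measure (X × Fin C))
    (S : Fin N → X × Fin C) (δ : ℝ) : ℝ :=
  ∑ i, classProb P i * ∑ _j ∈ Finset.univ.erase i,
    Real.sqrt (Real.log ((C : ℝ) * ((C : ℝ) - 1) / δ) / (2 * classCount S i))

/-- The right-hand side of the multiclass margin bound. -/
def multiclassMarginBound {X : Type*} [MeasurableSpace X] {C d N : ℕ}
    (P : Measure (X × Fin C)) (S : Fin N → X × Fin C) (F : Set (X → ℝ)) (K : ℝ)
    (M : Fin C → EuclideanSpace ℝ (Fin d)) (φ : X → EuclideanSpace ℝ (Fin d))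
    (γ : Fin C → Fin C → ℝ) (δ : ℝ) : ℝ :=
  (∑ i, classProb P i * ∑ j ∈ Finset.univ.erase i,
      rademacher (classCond P i) (classCount S i) F / γ i j)
  + (∑ i, classProb P i * ∑ j ∈ Finset.univ.erase i, confidence K (γ i j) (classCount S i))
  + empiricalRisk P S M φ γ
  + probabilityTerm P S δ

/-- The part of the first two sums of the multiclass margin bound that belongs to the ordered pairs
of classes in `A`. -/
def marginTerms {X : Type*} [MeasurableSpace X] {C N : ℕ}
    (P : Measure (X × Fin C)) (S : Fin N → X × Fin C) (F : Set (X → ℝ)) (K : ℝ)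
    (γ : Fin C → Fin C → ℝ) (A : Finset (Fin C × Fin C)) : ℝ :=
  (∑ q ∈ A, classProb P q.1 *
      (rademacher (classCond P q.1) (classCount S q.1) F / γ q.1 q.2))
  + ∑ q ∈ A, classProb P q.1 * confidence K (γ q.1 q.2) (classCount S q.1)

/-- The minority classes: all but the first `C₁` classes. -/
def minority (C C₁ : ℕ) : Finset (Fin C) :=
  Finset.univ.filter fun i => C₁ ≤ i.val

/-- Imbalanced classification: each of the first `C₁` classes has `N₁` samples in `S`, each
remaining class has `N₂`, and the class distribution of `P` is that of `S`. -/
structure IsImbalanced {X : Type*} [MeasurableSpace X] {C N : ℕ} (C₁ N₁ N₂ : ℕ)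
    (P : Measure (X × Fin C)) (S : Fin N → X × Fin C) : Prop where
  majority_count : ∀ i : Fin C, i.val < C₁ → classCount S i = N₁
  minority_count : ∀ i : Fin C, C₁ ≤ i.val → classCount S i = N₂
  classProb_eq : ∀ i : Fin C, classProb P i = (classCount S i : ℝ) / N

end MarginBound

end

namespace MarginBound

/-! The formula for the minority terms is counting: summing class sizes gives `N = C₁ N₁ + (C - C₁)
N₂`, so every minority class has weight `N₂ / N = 1 / (C₁ R + C - C₁)`.

For the asymptotics, this weight tends to `0` as `R → ∞`, while the complexities stay at most `K`,
because each conditional law is carried by its region. If all minority margins lie in `[ε, 2K]`, the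
remaining factors are bounded independently of the problem, so the terms fall below `c`
(`eventually_pairSum_lt`); this gives (a). For (b), all pairs share one margin `x`. The terms are
continuous in `x` on `(0, 2K]`, eventually below `c` at `2K`, and unbounded as `x → 0`, so the value
`c` is attained (`exists_pairSum_eq`). The argument of (a) then forces `x → 0`. -/

lemma sum_offDiag_eq {ι : Type*} [DecidableEq ι] (s : Finset ι) (g : ι → ι → ℝ) :
    ∑ q ∈ s.offDiag, g q.1 q.2 = ∑ i ∈ s, ∑ j ∈ s.erase i, g i j := by
  rw [Finset.sum_sigma']
  refine Finset.sum_bij' (fun q _ => ⟨q.1, q.2⟩) (fun q _ => (q.1, q.2)) ?_ ?_ ?_ ?_ ?_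
  · rintro ⟨i, j⟩ h
    simp only [Finset.mem_offDiag, Finset.mem_sigma, Finset.mem_erase] at h ⊢
    exact ⟨h.1, Ne.symm h.2.2, h.2.1⟩
  · rintro ⟨i, j⟩ h
    simp only [Finset.mem_offDiag, Finset.mem_sigma, Finset.mem_erase] at h ⊢
    exact ⟨h.1, h.2.2, Ne.symm h.2.1⟩
  all_goals simp

/-! ### Class sizes, minority weights and the splitting of the bound. -/

section Counting

variable {X : Type*} {C N : ℕ}

lemma sum_classCount (S : Fin N → X × Fin C) : ∑ i, classCount S i = N := by
  have h := Finset.card_eq_sum_card_fiberwise (f := fun k => (S k).2)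
    (s := Finset.univ) (t := Finset.univ) (fun _ _ => Finset.mem_coe.2 (Finset.mem_univ _))
  simpa [classCount] using h.symm

lemma card_minority (C C₁ : ℕ) : (minority C C₁).card = C - C₁ := by
  have h : (minority C C₁).card = ((Finset.range C).filter fun i => C₁ ≤ i).card := by
    rw [minority, ← Finset.card_map Fin.valEmbedding]
    congr 1
    ext a
    simp only [Finset.mem_map, Finset.mem_filter, Finset.mem_univ, true_and, Finset.mem_range,
      Fin.valEmbedding_apply]
    exact ⟨by rintro ⟨b, hb, rfl⟩; exact ⟨b.2, hb⟩, fun h => ⟨⟨a, h.1⟩, h.2, rfl⟩⟩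
  rw [h, show ((Finset.range C).filter fun i => C₁ ≤ i) = Finset.Ico C₁ C by
    ext a; simp [and_comm], Nat.card_Ico]

variable [MeasurableSpace X]

lemma IsImbalanced.size_eq {C₁ N₁ N₂ : ℕ} {P : Measure (X × Fin C)} {S : Fin N → X × Fin C}
    (h : IsImbalanced C₁ N₁ N₂ P S) (hC : C₁ ≤ C) : N = C₁ * N₁ + (C - C₁) * N₂ := by
  have hcount : ∀ i, classCount S i = if C₁ ≤ i.val then N₂ else N₁ := fun i => by
    split_ifs with hi
    · exact h.minority_count i hi
    · exact h.majority_count i (not_le.1 hi)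
  have hcard := card_minority C C₁
  have hcompl := Finset.card_filter_add_card_filter_not
    (s := (Finset.univ : Finset (Fin C))) (fun i => C₁ ≤ i.val)
  rw [minority] at hcard
  rw [hcard, Finset.card_univ, Fintype.card_fin] at hcompl
  have hmaj : (Finset.univ.filter fun i : Fin C => ¬ C₁ ≤ i.val).card = C₁ := by omega
  have hsum := sum_classCount S
  simp only [hcount, Finset.sum_ite, Finset.sum_const, smul_eq_mul] at hsum
  rw [hcard, hmaj] at hsum
  omega

lemma IsImbalanced.classProb_minority {C₁ N₁ N₂ : ℕ} {P : Measure (X × Fin C)}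
    {S : Fin N → X × Fin C} (h : IsImbalanced C₁ N₁ N₂ P S) (hC : C₁ ≤ C) (hN₂ : 0 < N₂)
    {i : Fin C} (hi : i ∈ minority C C₁) :
    classProb P i = 1 / ((C₁ : ℝ) * ((N₁ : ℝ) / N₂) + (C : ℝ) - C₁) := by
  have hi' : C₁ ≤ i.val := by simpa [minority] using hi
  rw [h.classProb_eq, h.minority_count i hi']
  have hN : (N : ℝ) = C₁ * N₁ + ((C : ℝ) - C₁) * N₂ := by
    rw [h.size_eq hC]; push_cast [Nat.cast_sub hC]; ring
  have h2 : (N₂ : ℝ) ≠ 0 := by positivity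
  rw [hN, show (C₁ : ℝ) * ((N₁ : ℝ) / N₂) + C - C₁ = (C₁ * N₁ + ((C : ℝ) - C₁) * N₂) / N₂ by
    field_simp; ring, one_div_div]

lemma IsImbalanced.marginTerms_minority {C₁ N₁ N₂ : ℕ} {P : Measure (X × Fin C)}
    {S : Fin N → X × Fin C} (h : IsImbalanced C₁ N₁ N₂ P S) (hC : C₁ ≤ C) (hN₂ : 0 < N₂)
    (F : Set (X → ℝ)) (K : ℝ) (γ : Fin C → Fin C → ℝ) :
    marginTerms P S F K γ (minority C C₁).offDiag =
      ∑ i ∈ minority C C₁, ∑ j ∈ (minority C C₁).erase i,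
        1 / ((C₁ : ℝ) * ((N₁ : ℝ) / N₂) + (C : ℝ) - C₁) *
          (rademacher (classCond P i) N₂ F / γ i j + confidence K (γ i j) N₂) := by
  rw [marginTerms, ← Finset.sum_add_distrib, ← sum_offDiag_eq]
  refine Finset.sum_congr rfl fun q hq => ?_
  have hq1 := (Finset.mem_offDiag.1 hq).1
  rw [h.classProb_minority hC hN₂ hq1, h.minority_count q.1 (by simpa [minority] using hq1)]
  ring

lemma multiclassMarginBound_eq {d : ℕ} (P : Measure (X × Fin C)) (S : Fin N → X × Fin C)
    (F : Set (X → ℝ)) (K : ℝ) (M : Fin C → EuclideanSpace ℝ (Fin d))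
    (φ : X → EuclideanSpace ℝ (Fin d)) (γ : Fin C → Fin C → ℝ) (δ : ℝ) (A : Finset (Fin C)) :
    multiclassMarginBound P S F K M φ γ δ =
      marginTerms P S F K γ A.offDiag + marginTerms P S F K γ (Finset.univ.offDiag \ A.offDiag)
        + empiricalRisk P S M φ γ + probabilityTerm P S δ := by
  have hsub : A.offDiag ⊆ (Finset.univ : Finset (Fin C)).offDiag :=
    Finset.offDiag_mono (Finset.subset_univ A)
  have hsplit : marginTerms P S F K γ A.offDiag
      + marginTerms P S F K γ (Finset.univ.offDiag \ A.offDiag)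
      = marginTerms P S F K γ Finset.univ.offDiag := by
    simp only [marginTerms]
    rw [← Finset.sum_sdiff hsub (f := fun q : Fin C × Fin C => classProb P q.1 *
        (rademacher (classCond P q.1) (classCount S q.1) F / γ q.1 q.2)),
      ← Finset.sum_sdiff hsub (f := fun q : Fin C × Fin C =>
        classProb P q.1 * confidence K (γ q.1 q.2) (classCount S q.1))]
    ring
  rw [hsplit, multiclassMarginBound, marginTerms]
  rw [sum_offDiag_eq Finset.univ (fun i j => classProb P i *
      (rademacher (classCond P i) (classCount S i) F / γ i j)),
    sum_offDiag_eq Finset.univ (fun i j =>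
      classProb P i * confidence K (γ i j) (classCount S i))]
  simp only [Finset.mul_sum]

end Counting

/-! ### Uniform bounds on the Rademacher complexity. -/

section Rademacher

variable {X : Type*} [MeasurableSpace X]

lemma rademacher_nonneg (D : Measure X) (n : ℕ) (F : Set (X → ℝ)) : 0 ≤ rademacher D n F :=
  ENNReal.toReal_nonneg

lemma rademacher_le (D : Measure X) [IsProbabilityMeasure D] (n : ℕ) (F : Set (X → ℝ)) {K : ℝ}
    (hK : 0 ≤ K) (A : Set X) (hA : ∀ᵐ x ∂D, x ∈ A) (hF : ∀ g ∈ F, ∀ x ∈ A, |g x| ≤ K) :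
    rademacher D n F ≤ K := by
  refine ENNReal.toReal_le_of_le_ofReal hK ?_
  have hae : ∀ᵐ x : Fin n → X ∂(Measure.pi fun _ => D), ∀ k, x k ∈ A :=
    ae_all_iff.2 fun k => (Measure.tendsto_eval_ae_ae (μ := fun _ : Fin n => D) (i := k)) hA
  calc _ ≤ ∫⁻ _ : Fin n → X, ENNReal.ofReal K ∂(Measure.pi fun _ => D) := by
        refine lintegral_mono_ae (hae.mono fun x hx => ?_)
        refine ENNReal.div_le_of_le_mul ?_
        have hterm : ∀ σ : Fin n → ℤˣ,
            (⨆ g ∈ F, ENNReal.ofReal |(1 / (n : ℝ)) * ∑ k, ((σ k : ℤ) : ℝ) * g (x k)|)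
              ≤ ENNReal.ofReal K := by
          refine fun σ => iSup₂_le fun g hg => ENNReal.ofReal_le_ofReal ?_
          have hsum : |∑ k, ((σ k : ℤ) : ℝ) * g (x k)| ≤ n * K := by
            refine (Finset.abs_sum_le_sum_abs _ _).trans ?_
            calc _ ≤ ∑ _k : Fin n, K := Finset.sum_le_sum fun k _ => by
                  have hs : |((σ k : ℤ) : ℝ)| = 1 := by
                    rcases Int.units_eq_one_or (σ k) with h | h <;> simp [h]
                  rw [abs_mul, hs, one_mul]
                  exact hF g hg _ (hx k)
              _ = n * K := by simp
          -- For `n = 0` the sum is empty and the average is `0`.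
          rcases Nat.eq_zero_or_pos n with rfl | hn
          · simpa using hK
          · have hn' : (0 : ℝ) < n := by exact_mod_cast hn
            rw [abs_mul, abs_of_pos (by positivity), one_div, inv_mul_le_iff₀ hn']
            exact hsum
        calc _ ≤ ∑ _σ : Fin n → ℤˣ, ENNReal.ofReal K := Finset.sum_le_sum fun σ _ => hterm σ
          _ = ENNReal.ofReal K * 2 ^ n := by
            simp [mul_comm]
    _ = ENNReal.ofReal K := by simp

variable {C : ℕ}

lemma isProbabilityMeasure_classCond (P : Measure (X × Fin C)) [IsProbabilityMeasure P]
    {i : Fin C} (hi : 0 < classProb P i) : IsProbabilityMeasure (classCond P i) := by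
  have hne : P (Prod.snd ⁻¹' {i}) ≠ 0 := fun h => by simp [classProb, Measure.real, h] at hi
  have := cond_isProbabilityMeasure hne
  exact Measure.isProbabilityMeasure_map measurable_fst.aemeasurable

lemma ae_classCond_mem (P : Measure (X × Fin C)) (region : Fin C → Set X)
    (h : ∀ᵐ z ∂P, z.1 ∈ region z.2) (i : Fin C) : ∀ᵐ x ∂(classCond P i), x ∈ region i := by
  -- The regions need not be measurable, so the exceptional null set is enlarged to a measurable one
  -- before the pushforward and the conditioning are evaluated.
  obtain ⟨T, hT, hTm, hT0⟩ := exists_measurable_superset_of_null (ae_iff.1 h)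
  have hsec : MeasurableSet ((fun x : X => (x, i)) ⁻¹' T) := measurable_prodMk_right hTm
  refine measure_mono_null (t := (fun x : X => (x, i)) ⁻¹' T) (fun x hx => hT hx) ?_
  have hi : MeasurableSet (Prod.snd ⁻¹' {i} : Set (X × Fin C)) :=
    measurable_snd (measurableSet_singleton i)
  rw [classCond, Measure.map_apply measurable_fst hsec, cond_apply hi]
  refine mul_eq_zero_of_right _ (measure_mono_null ?_ hT0)
  rintro ⟨x, y⟩ ⟨hy, hx⟩
  obtain rfl : y = i := hy
  exact hx

lemma IsImbalanced.rademacher_le {N C₁ N₁ N₂ : ℕ} {P : Measure (X × Fin C)}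
    [IsProbabilityMeasure P] {S : Fin N → X × Fin C} (h : IsImbalanced C₁ N₁ N₂ P S)
    (hC : C₁ ≤ C) (hN₂ : 0 < N₂) {region : Fin C → Set X}
    (hreg : ∀ᵐ z ∂P, z.1 ∈ region z.2) {F : Set (X → ℝ)} {K : ℝ} (hK : 0 ≤ K)
    (hF : ∀ g ∈ F, ∀ i, ∀ x ∈ region i, |g x| ≤ K) {i : Fin C} (hi : i ∈ minority C C₁) (n : ℕ) :
    rademacher (classCond P i) n F ≤ K := by
  have hi' : C₁ ≤ i.val := by simpa [minority] using hi
  have hlt : C₁ < C := hi'.trans_lt i.2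
  have hlt' : (C₁ : ℝ) < C := by exact_mod_cast hlt
  -- Conditioning on a label yields a probability measure only if the label has positive mass.
  have hpos : 0 < classProb P i := by
    rw [h.classProb_minority hC hN₂ hi]
    have : 0 ≤ (C₁ : ℝ) * ((N₁ : ℝ) / N₂) := by positivity
    exact one_div_pos.2 (by linarith)
  have := isProbabilityMeasure_classCond P hpos
  exact MarginBound.rademacher_le _ n F hK (region i) (ae_classCond_mem P region hreg i)
    fun g hg x hx => hF g hg i x hx

end Rademacher

/-! ### The iterated-logarithm term as a function of the margin. -/

section Confidence

variable {K : ℝ}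

/-- This is where `γ ≤ 2K` enters: it means `4K / γ ≥ 2`, which keeps the outer logarithm
nonnegative and its argument away from `0`. -/
lemma one_le_logb {γ : ℝ} (hγ : 0 < γ) (hγK : γ ≤ 2 * K) : 1 ≤ Real.logb 2 (4 * K / γ) := by
  rw [Real.le_logb_iff_rpow_le (by norm_num) (div_pos (by linarith) hγ), Real.rpow_one,
    le_div_iff₀ hγ]
  linarith

lemma confidence_le (hK : 0 < K) {γ ε : ℝ} (hε : 0 < ε) (hεγ : ε ≤ γ) (hγK : γ ≤ 2 * K) {n : ℕ}
    (hn : 0 < n) : confidence K γ n ≤ Real.sqrt (Real.log (Real.logb 2 (4 * K / ε))) := by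
  have h1 := one_le_logb (hε.trans_le hεγ) hγK
  refine Real.sqrt_le_sqrt ?_
  refine (div_le_self (Real.log_nonneg h1) (by exact_mod_cast hn)).trans ?_
  refine Real.log_le_log (by linarith) ?_
  have h4 : 0 < 4 * K / γ := div_pos (by linarith) (hε.trans_le hεγ)
  exact Real.logb_le_logb_of_le (by norm_num) h4
    (div_le_div_of_nonneg_left (by linarith) hε hεγ)

lemma continuousOn_confidence (hK : 0 < K) (n : ℕ) :
    ContinuousOn (fun γ => confidence K γ n) (Set.Ioc 0 (2 * K)) := by
  intro γ hγ
  have hlog := one_le_logb hγ.1 hγ.2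
  have h0 : γ ≠ 0 := hγ.1.ne'
  have h4 : 4 * K / γ ≠ 0 := (div_pos (by linarith) hγ.1).ne'
  have hdiv : ContinuousAt (fun γ : ℝ => 4 * K / γ) γ := continuousAt_const.div continuousAt_id h0
  have hlogb : ContinuousAt (fun γ : ℝ => Real.logb 2 (4 * K / γ)) γ :=
    (hdiv.log h4).div_const (Real.log 2)
  exact ((hlogb.log (by linarith)).div_const (n : ℝ)).sqrt.continuousWithinAt

/-- The blow-up at small margins is drawn from this term because the Rademacher complexity may
vanish. -/
lemma tendsto_confidence (hK : 0 < K) {n : ℕ} (hn : 0 < n) :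
    Tendsto (fun γ => confidence K γ n) (𝓝[>] 0) atTop := by
  have hdiv : Tendsto (fun γ : ℝ => 4 * K / γ) (𝓝[>] 0) atTop :=
    tendsto_inv_nhdsGT_zero.const_mul_atTop (by linarith)
  have hn' : (0 : ℝ) < n := by exact_mod_cast hn
  exact Real.tendsto_sqrt_atTop.comp ((Real.tendsto_log_atTop.comp
    ((Real.tendsto_logb_atTop (by norm_num)).comp hdiv)).atTop_div_const hn')

end Confidence

/-! ### Vanishing weights and the choice of margins. -/

section Asymptotics

/-- The minority margin terms for the weight `q`, the complexities `ρ i` and the margins `γ`. -/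
noncomputable def pairSum {ι : Type*} [DecidableEq ι] (s : Finset ι) (K q : ℝ) (n : ℕ) (ρ : ι → ℝ)
    (γ : ι → ι → ℝ) : ℝ :=
  ∑ i ∈ s, ∑ j ∈ s.erase i, q * (ρ i / γ i j + confidence K (γ i j) n)

variable {ι : Type*} [DecidableEq ι] {s : Finset ι} {K : ℝ}

lemma pairSum_le (hK : 0 < K) {q : ℝ} (hq : 0 ≤ q) {n : ℕ} (hn : 0 < n) {ρ : ι → ℝ}
    (hρK : ∀ i ∈ s, ρ i ≤ K) {γ : ι → ι → ℝ} {ε : ℝ} (hε : 0 < ε)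
    (hγ : ∀ i ∈ s, ∀ j ∈ s, i ≠ j → ε ≤ γ i j ∧ γ i j ≤ 2 * K) :
    pairSum s K q n ρ γ ≤ q * (∑ i ∈ s, ∑ _j ∈ s.erase i,
      (K / ε + Real.sqrt (Real.log (Real.logb 2 (4 * K / ε))))) := by
  simp only [pairSum, Finset.mul_sum]
  refine Finset.sum_le_sum fun i hi => Finset.sum_le_sum fun j hj => ?_
  obtain ⟨hji, hj⟩ := Finset.mem_erase.1 hj
  obtain ⟨h1, h2⟩ := hγ i hi j hj hji.symm
  exact mul_le_mul_of_nonneg_left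
    (add_le_add (div_le_div₀ hK.le (hρK i hi) hε h1) (confidence_le hK hε h1 h2 hn)) hq

/-- The threshold in `t` is uniform in `γ`, so the margins may afterwards be chosen depending on
`t`. -/
lemma eventually_pairSum_lt (hK : 0 < K) {q : ℕ → ℝ} (hq : ∀ t, 0 ≤ q t)
    (hq0 : Tendsto q atTop (𝓝 0)) {n : ℕ → ℕ} (hn : ∀ t, 0 < n t) {ρ : ℕ → ι → ℝ}
    (hρK : ∀ t, ∀ i ∈ s, ρ t i ≤ K) {ε c : ℝ} (hε : 0 < ε) (hc : 0 < c) :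
    ∀ᶠ t in atTop, ∀ γ : ι → ι → ℝ,
      (∀ i ∈ s, ∀ j ∈ s, i ≠ j → ε ≤ γ i j ∧ γ i j ≤ 2 * K) →
        pairSum s K (q t) (n t) (ρ t) γ < c := by
  have hlim := hq0.mul_const (∑ i ∈ s, ∑ _j ∈ s.erase i,
    (K / ε + Real.sqrt (Real.log (Real.logb 2 (4 * K / ε)))))
  rw [zero_mul] at hlim
  filter_upwards [hlim.eventually_lt_const hc] with t ht γ hγ
  exact (pairSum_le hK (hq t) (hn t) (hρK t) hε hγ).trans_lt ht

lemma exists_pairSum_eq (hK : 0 < K) (hs : 1 < s.card) {q : ℝ} (hq : 0 < q) {n : ℕ} (hn : 0 < n)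
    {ρ : ι → ℝ} (hρ : ∀ i ∈ s, 0 ≤ ρ i) {c : ℝ}
    (hc : pairSum s K q n ρ (fun _ _ => 2 * K) < c) :
    ∃ x ∈ Set.Ioc 0 (2 * K), pairSum s K q n ρ (fun _ _ => x) = c := by
  -- A single pair `(a, b)` already pushes the sum above `c` at a small margin; the other summands
  -- are nonnegative.
  obtain ⟨a, ha, b, hb, hab⟩ := Finset.one_lt_card.1 hs
  have hlarge := (((tendsto_confidence hK hn).const_mul_atTop hq).eventually_ge_atTop c).and
    (Ioc_mem_nhdsGT (show (0 : ℝ) < 2 * K by linarith))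
  obtain ⟨x, hx, hx0⟩ := hlarge.exists
  have hnonneg : ∀ i ∈ s, 0 ≤ q * (ρ i / x + confidence K x n) := fun i hi =>
    mul_nonneg hq.le (add_nonneg (div_nonneg (hρ i hi) hx0.1.le) (Real.sqrt_nonneg _))
  have hxc : c ≤ pairSum s K q n ρ (fun _ _ => x) := by
    calc c ≤ q * (ρ a / x + confidence K x n) := by
          have := mul_nonneg hq.le (div_nonneg (hρ a ha) hx0.1.le)
          linarith
      _ ≤ ∑ _j ∈ s.erase a, q * (ρ a / x + confidence K x n) :=
          Finset.single_le_sum (f := fun _ => q * (ρ a / x + confidence K x n))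
            (fun _ _ => hnonneg a ha) (Finset.mem_erase.2 ⟨hab.symm, hb⟩)
      _ ≤ _ := Finset.single_le_sum
          (f := fun i => ∑ _j ∈ s.erase i, q * (ρ i / x + confidence K x n))
          (fun i hi => Finset.sum_nonneg fun _ _ => hnonneg i hi) ha
  have hcont : ContinuousOn (fun y => pairSum s K q n ρ (fun _ _ => y)) (Set.Ioc 0 (2 * K)) := by
    refine continuousOn_finsetSum _ fun i _ => continuousOn_finsetSum _ fun j _ => ?_
    exact continuousOn_const.mul ((continuousOn_const.div continuousOn_id
      fun y hy => hy.1.ne').add (continuousOn_confidence hK n))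
  have hsub : Set.Icc x (2 * K) ⊆ Set.Ioc 0 (2 * K) := fun y hy => ⟨hx0.1.trans_le hy.1, hy.2⟩
  obtain ⟨y, hy, hyc⟩ := intermediate_value_Icc' hx0.2 (hcont.mono hsub) ⟨hc.le, hxc⟩
  exact ⟨y, hsub hy, hyc⟩

/-- Along vanishing weights, there are common margins tending to `0` for which the minority margin
terms are eventually equal to `c`. -/
lemma exists_margins (hK : 0 < K) (hs : 1 < s.card) {q : ℕ → ℝ} (hq : ∀ t, 0 < q t)
    (hq0 : Tendsto q atTop (𝓝 0)) {n : ℕ → ℕ} (hn : ∀ t, 0 < n t) {ρ : ℕ → ι → ℝ}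
    (hρ : ∀ t, ∀ i ∈ s, 0 ≤ ρ t i) (hρK : ∀ t, ∀ i ∈ s, ρ t i ≤ K) {c : ℝ} (hc : 0 < c) :
    ∃ x : ℕ → ℝ, (∀ t, 0 < x t ∧ x t ≤ 2 * K) ∧ Tendsto x atTop (𝓝 0) ∧
      ∀ᶠ t in atTop, pairSum s K (q t) (n t) (ρ t) (fun _ _ => x t) = c := by
  have hex : ∀ t, ∃ x : ℝ, (0 < x ∧ x ≤ 2 * K) ∧
      (pairSum s K (q t) (n t) (ρ t) (fun _ _ => 2 * K) < c →
        pairSum s K (q t) (n t) (ρ t) (fun _ _ => x) = c) := fun t => by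
    by_cases h : pairSum s K (q t) (n t) (ρ t) (fun _ _ => 2 * K) < c
    · obtain ⟨x, hx, hxc⟩ := exists_pairSum_eq hK hs (hq t) (hn t) (hρ t) h
      exact ⟨x, hx, fun _ => hxc⟩
    · exact ⟨2 * K, ⟨by linarith, le_rfl⟩, fun h' => absurd h' h⟩
  choose x hx hxc using hex
  have hsmall : ∀ ε : ℝ, 0 < ε → _ := fun ε hε =>
    eventually_pairSum_lt (s := s) hK (fun t => (hq t).le) hq0 hn hρK (ε := ε) hε hc
  have heq : ∀ᶠ t in atTop, pairSum s K (q t) (n t) (ρ t) (fun _ _ => x t) = c := by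
    -- With `ε = 2K` the constant margin `2K` is admissible, so the terms there are eventually below
    -- `c`.
    filter_upwards [hsmall (2 * K) (by linarith)] with t ht
    exact hxc t (ht _ fun _ _ _ _ _ => ⟨le_rfl, le_rfl⟩)
  refine ⟨x, hx, ?_, heq⟩
  refine tendsto_order.2 ⟨fun a ha => Eventually.of_forall fun t => ha.trans (hx t).1,
    fun ε hε => ?_⟩
  filter_upwards [hsmall ε hε, heq] with t ht hteq
  by_contra! hle
  -- A common margin of at least `ε` would make the terms strictly less than `c`, yet they equal
  -- `c`.
  exact (ht (fun _ _ => x t) fun _ _ _ _ _ => ⟨hle, (hx t).2⟩).ne hteq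

lemma tendsto_minority_weight {C C₁ : ℕ} (hC₁ : 0 < C₁) {R : ℕ → ℝ} (hR : Tendsto R atTop atTop) :
    Tendsto (fun t => 1 / ((C₁ : ℝ) * R t + (C : ℝ) - C₁)) atTop (𝓝 0) := by
  have hC₁' : (0 : ℝ) < C₁ := by exact_mod_cast hC₁
  simp only [add_sub_assoc, one_div]
  exact (tendsto_atTop_add_const_right _ _ (hR.const_mul_atTop hC₁')).inv_tendsto_atTop

end Asymptotics

end MarginBound

open MarginBound in
theorem mainTheorem6
    {X : Type*} [MeasurableSpace X] {W : Type*} {C d : ℕ} (C₁ : ℕ) (hC : C₁ ≤ C)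
    (f : W → X → EuclideanSpace ℝ (Fin d))
    (H : Set ((Fin C → EuclideanSpace ℝ (Fin d)) × W))
    (region : Fin C → Set X) (K : ℝ) (hK : 0 < K)
    (hF : ∀ g ∈ marginClass f H, ∀ i, ∀ x ∈ region i, |g x| ≤ K) :
    -- the minority-pair terms, and their place in the whole bound
    (∀ (N N₁ N₂ : ℕ) (P : Measure (X × Fin C)) [IsProbabilityMeasure P]
        (S : Fin N → X × Fin C),
      0 < N₁ → 0 < N₂ → (∀ᵐ z ∂P, z.1 ∈ region z.2) → IsImbalanced C₁ N₁ N₂ P S →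
      ∀ (h : (Fin C → EuclideanSpace ℝ (Fin d)) × W), h ∈ H →
      ∀ (γ : Fin C → Fin C → ℝ), (∀ i j, i ≠ j → 0 < γ i j) →
      ∀ (R : ℝ), R = (N₁ : ℝ) / N₂ →
        marginTerms P S (marginClass f H) K γ (minority C C₁).offDiag =
          ∑ i ∈ minority C C₁, ∑ j ∈ (minority C C₁).erase i,
            1 / ((C₁ : ℝ) * R + (C : ℝ) - C₁) *
              (rademacher (classCond P i) N₂ (marginClass f H) / γ i j +
                Real.sqrt (Real.log (Real.logb 2 (4 * K / γ i j)) / N₂)) ∧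
        ∀ δ : ℝ, 0 < δ → δ < 1 →
          multiclassMarginBound P S (marginClass f H) K h.1 (f h.2) γ δ =
            (∑ i ∈ minority C C₁, ∑ j ∈ (minority C C₁).erase i,
              1 / ((C₁ : ℝ) * R + (C : ℝ) - C₁) *
                (rademacher (classCond P i) N₂ (marginClass f H) / γ i j +
                  Real.sqrt (Real.log (Real.logb 2 (4 * K / γ i j)) / N₂)))
            + marginTerms P S (marginClass f H) K γ
                (Finset.univ.offDiag \ (minority C C₁).offDiag)
            + empiricalRisk P S h.1 (f h.2) γ
            + probabilityTerm P S δ) ∧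
    -- the behaviour as the imbalance ratio tends to infinity
    (∀ (N N₁ N₂ : ℕ → ℕ) (P : ℕ → Measure (X × Fin C)) [∀ t, IsProbabilityMeasure (P t)]
        (S : ∀ t, Fin (N t) → X × Fin C),
      0 < C₁ → C₁ + 2 ≤ C →
      (∀ t, 0 < N₁ t) → (∀ t, 0 < N₂ t) → (∀ t, ∀ᵐ z ∂(P t), z.1 ∈ region z.2) →
      (∀ t, IsImbalanced C₁ (N₁ t) (N₂ t) (P t) (S t)) →
      Tendsto (fun t => (N₁ t : ℝ) / N₂ t) atTop atTop →
      ∀ c : ℝ, 0 < c →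
        (∀ γ : ℕ → Fin C → Fin C → ℝ,
          (∀ t, ∀ i ∈ minority C C₁, ∀ j ∈ minority C C₁, i ≠ j →
            0 < γ t i j ∧ γ t i j ≤ 2 * K) →
          (∀ᶠ t in atTop, c ≤ marginTerms (P t) (S t) (marginClass f H) K (γ t)
            (minority C C₁).offDiag) →
          ∀ ε : ℝ, 0 < ε → ∀ᶠ t in atTop,
            ∃ i ∈ minority C C₁, ∃ j ∈ minority C C₁, i ≠ j ∧ γ t i j < ε) ∧
        (∃ γ : ℕ → Fin C → Fin C → ℝ,
          (∀ t i j, 0 < γ t i j ∧ γ t i j ≤ 2 * K) ∧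
          (∀ i ∈ minority C C₁, ∀ j ∈ minority C C₁, i ≠ j →
            Tendsto (fun t => γ t i j) atTop (𝓝 0)) ∧
          ∀ᶠ t in atTop, marginTerms (P t) (S t) (marginClass f H) K (γ t)
            (minority C C₁).offDiag = c)) := by
  refine ⟨?_, ?_⟩
  · intro N N₁ N₂ P _ S _ hN₂ _ hS h _ γ _ R hR
    subst hR
    have hmin := hS.marginTerms_minority hC hN₂ (marginClass f H) K γ
    refine ⟨hmin, fun δ _ _ => ?_⟩
    rw [multiclassMarginBound_eq P S _ K h.1 (f h.2) γ δ (minority C C₁), hmin]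
    rfl
  · intro N N₁ N₂ P _ S hC₁ hC2 hN₁ hN₂ hreg hS hR c hc
    set q : ℕ → ℝ := fun t => 1 / ((C₁ : ℝ) * ((N₁ t : ℝ) / N₂ t) + (C : ℝ) - C₁)
    set ρ : ℕ → Fin C → ℝ := fun t i => rademacher (classCond (P t) i) (N₂ t) (marginClass f H)
    have hlt : (C₁ : ℝ) < C := by exact_mod_cast (by omega : C₁ < C)
    have hq : ∀ t, 0 < q t := fun t => by
      have : 0 ≤ (C₁ : ℝ) * ((N₁ t : ℝ) / N₂ t) := by positivity
      exact one_div_pos.2 (by linarith)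
    have hq0 : Tendsto q atTop (𝓝 0) := tendsto_minority_weight hC₁ hR
    have hρ : ∀ t, ∀ i ∈ minority C C₁, 0 ≤ ρ t i := fun t i _ => rademacher_nonneg _ _ _
    have hρK : ∀ t, ∀ i ∈ minority C C₁, ρ t i ≤ K := fun t i hi =>
      (hS t).rademacher_le hC (hN₂ t) (hreg t) hK.le hF hi _
    have hterms : ∀ t γ, marginTerms (P t) (S t) (marginClass f H) K γ (minority C C₁).offDiag
        = pairSum (minority C C₁) K (q t) (N₂ t) (ρ t) γ := fun t γ =>
      (hS t).marginTerms_minority hC (hN₂ t) _ K γ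
    simp only [hterms]
    refine ⟨fun γ hγ hge ε hε => ?_, ?_⟩
    · filter_upwards [hge, eventually_pairSum_lt hK (fun t => (hq t).le) hq0 hN₂ hρK hε hc]
        with t htc ht
      by_contra! hno
      exact absurd htc (not_le.2 (ht (γ t) fun i hi j hj hij =>
        ⟨hno i hi j hj hij, (hγ t i hi j hj hij).2⟩))
    · have hs : 1 < (minority C C₁).card := by rw [card_minority]; omega
      obtain ⟨x, hx, hx0, hxc⟩ := exists_margins hK hs hq hq0 hN₂ hρ hρK hc
      exact ⟨fun t _ _ => x t, fun t _ _ => hx t, fun _ _ _ _ _ => hx0, hxc⟩
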